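/- Let $(R,\mathfrak m)$ be a Cohen–Macaulay local ring of Krull dimension $2$ (in particular Noetherian), and let $\mathcal F=\{I_n\}_{n\ge 0}$ be a Hilbert filtration of $R$, i.e. a decreasing sequence of ideals with $I_0=R$, $I_nI_m\subseteq I_{n+m}$ for all $n,m$, $I_1I_n=I_{n+1}$ for all $n\gg 0$, and $I_1$ $\mathfrak m$-primary. Let $\lambda$ denote length. Let $e_0(\mathcal F),e_1(\mathcal F),e_2(\mathcal F)$ be the Hilbert coefficients of $\mathcal F$, i.e. the unique integers such that $$\lambda(R/I_n)=e_0(\mathcal F)\binom{n+1}{2}-e_1(\mathcal F)\,n+e_2(\mathcal F)\qquad\text{for all } n\gg 0 .$$ Suppose that $J=(x,y)$ is a minimal reduction of $I_1$ generated by two elements (a reduction of $I_1$ is an ideal $J\subseteq I_1$ with $JI_1^r=I_1^{r+1}$ for some $r\ge 0$; minimal means minimal under inclusion). For $n\ge 0$ put $$rr(I_n)=\bigcup_{k\ge 1}\,(I_{n+k}:I_1^k),$$ and let $$v_0=e_0(\mathcal F)-\lambda(R/rr(I_0)),\qquad v_1=e_0(\mathcal F)-\lambda(R/rr(I_1))+2\lambda(R/rr(I_0)),$$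 $$v_n=\lambda\!\left(\frac{rr(I_n)}{J\,rr(I_{n-1})}\right)\quad\text{for } n\ge 2 .$$ Then the Hilbert coefficients exist and are unique, $v_n=0$ for all but finitely many $n$, and $$e_1(\mathcal F)=\sum_{n\ge 1}v_n\qquad\text{and}\qquad e_2(\mathcal F)=\sum_{n\ge 1}(n-1)v_n .$$ -/

import Mathlib

namespace HilbertFiltration

open Filter

section Rings

variable (R : Type*) [CommRing R]

/-- The depth of a local ring: the supremum of the lengths of the `R`-regular sequences
contained in the maximal ideal. -/
noncomputable def depth [IsLocalRing R] : ℕ∞ :=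
  ⨆ (rs : List R) (_ : RingTheory.Sequence.IsRegular R rs ∧
    ∀ r ∈ rs, r ∈ IsLocalRing.maximalIdeal R), (rs.length : ℕ∞)

/-- A Noetherian local ring is Cohen–Macaulay if its depth equals its Krull dimension. -/
structure IsCohenMacaulayLocal [IsLocalRing R] : Prop where
  noetherian : IsNoetherianRing R
  depth_eq : ((depth R : ℕ∞) : WithBot ℕ∞) = ringKrullDim R

/-- The length `λ(M)` of an `R`-module as an integer (meaningful if the length is finite). -/
noncomputable def len (M : Type*) [AddCommGroup M] [Module R M] : ℤ :=
  ((Module.length R M).toNat : ℤ)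

end Rings

variable {R : Type*} [CommRing R]

/-- A Hilbert filtration of a local ring: a decreasing multiplicative filtration
`R = I₀ ⊇ I₁ ⊇ I₂ ⊇ ⋯` by ideals such that `I₁ Iₙ = Iₙ₊₁` for all large `n`, and such that
`I₁` is primary to the maximal ideal. -/
structure IsHilbertFiltration [IsLocalRing R] (F : ℕ → Ideal R) : Prop where
  zero_eq_top : F 0 = ⊤
  antitone : Antitone F
  mul_le : ∀ n m, F n * F m ≤ F (n + m)
  good : ∃ p, ∀ n, p ≤ n → F 1 * F n = F (n + 1)
  isPrimary : (F 1).IsPrimary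
  radical_eq : (F 1).radical = IsLocalRing.maximalIdeal R

/-- `J` is a reduction of `I`: `J ⊆ I` and `J Iʳ = Iʳ⁺¹` for some `r`. -/
def IsReduction (J I : Ideal R) : Prop :=
  J ≤ I ∧ ∃ r : ℕ, J * I ^ r = I ^ (r + 1)

/-- A minimal reduction is a reduction that is minimal with respect to inclusion. -/
def IsMinimalReduction (J I : Ideal R) : Prop :=
  Minimal (fun J' => IsReduction J' I) J

/-- `e₀, …, e_d` are Hilbert coefficients of `F` (in dimension `d`): for all large `n`, the length
`λ(R / Iₙ)` is finite and equals
`e₀ (n+d-1 choose d) - e₁ (n+d-2 choose d-1) + ⋯ + (-1)^d e_d`.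
No subtraction below truncates once `n ≥ 1`. -/
def IsHilbertCoeffs (d : ℕ) (F : ℕ → Ideal R) (e : Fin (d + 1) → ℤ) : Prop :=
  ∀ᶠ n : ℕ in atTop, Module.length R (R ⧸ F n) ≠ ⊤ ∧
    len R (R ⧸ F n) =
      ∑ i : Fin (d + 1), (-1) ^ (i : ℕ) * e i * ((Nat.choose (n + d - 1 - (i : ℕ)) (d - (i : ℕ)) : ℕ) : ℤ)

/-- The Hilbert coefficients `e₀(F), …, e_d(F)`, whenever they exist. -/
noncomputable def hilbertCoeff (d : ℕ) (F : ℕ → Ideal R) : Fin (d + 1) → ℤ :=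
  Classical.epsilon (IsHilbertCoeffs d F)

/-- The Ratliff–Rush closure of `F` with respect to `K`: its `n`-th ideal is
`⋃_{k ≥ 1} (K Iₙ₊ₖ : I₁ᵏ)`, see `mem_rr_iff` for the union. -/
def rr (K : Ideal R) (F : ℕ → Ideal R) (n : ℕ) : Ideal R :=
  ⨆ k : {k : ℕ // 1 ≤ k}, (K * F (n + k)).colon ((F 1 ^ (k : ℕ) : Ideal R) : Set R)

theorem mem_rr_iff (K : Ideal R) (F : ℕ → Ideal R) (hF : ∀ n m, F n * F m ≤ F (n + m))
    (n : ℕ) (z : R) :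
    z ∈ rr K F n ↔ ∃ k : ℕ, 1 ≤ k ∧ ∀ a ∈ F 1 ^ k, z * a ∈ K * F (n + k) := by
  have hmono : Monotone fun k : {k : ℕ // 1 ≤ k} =>
      (K * F (n + k)).colon ((F 1 ^ (k : ℕ) : Ideal R) : Set R) := by
    rintro ⟨k, hk⟩ ⟨l, hl⟩ (hkl : k ≤ l)
    change (K * F (n + k)).colon ((F 1 ^ k : Ideal R) : Set R) ≤
      (K * F (n + l)).colon ((F 1 ^ l : Ideal R) : Set R)
    induction l, hkl using Nat.le_induction with
    | base => exact le_rfl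
    | succ l hkl ih =>
      refine (ih (hk.trans hkl)).trans fun z hz => ?_
      rw [Submodule.mem_colon] at hz ⊢
      intro s hs
      rw [SetLike.mem_coe, pow_succ] at hs
      refine Submodule.mul_induction_on hs (fun a ha b hb => ?_) (fun a b ha hb => ?_)
      · have h1 : (z * a) * b ∈ K * F (n + l) * F 1 := Ideal.mul_mem_mul (hz a ha) hb
        have h2 : K * F (n + l) * F 1 ≤ K * F (n + (l + 1)) := by
          rw [mul_assoc]
          exact Ideal.mul_mono_right (hF _ _)
        simpa [mul_assoc] using h2 h1
      · rw [smul_add]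
        exact add_mem ha hb
  have : Nonempty {k : ℕ // 1 ≤ k} := ⟨⟨1, le_rfl⟩⟩
  rw [rr, Submodule.mem_iSup_of_directed _ hmono.directed_le]
  simp [Submodule.mem_colon]

/-- The sequence `vₙ` attached to a filtration `F` (in dimension two), an ideal `K` and a minimal
reduction `J` of `I₁`. -/
noncomputable def v (K J : Ideal R) (F : ℕ → Ideal R) : ℕ → ℤ
  | 0 => hilbertCoeff 2 F 0 - len R (R ⧸ rr K F 0)
  | 1 => hilbertCoeff 2 F 0 - len R (R ⧸ rr K F 1) + 2 * len R (R ⧸ rr K F 0)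
  | n + 2 => len R (rr K F (n + 2) ⧸ (J * rr K F (n + 1)).submoduleOf (rr K F (n + 2)))

end HilbertFiltration

/-! Write h(n) = λ(R/rr(Iₙ)) and E = λ(R/J). Depth two makes every syzygy of x, y a Koszul one, and
because J is a reduction, rr(Iₙ) = (rr(Iₙ₊₁) : J). So the Koszul complex yields an exact sequence 0
→ R/rr(Iₙ) → (R/rr(Iₙ₊₁))² → R/J·rr(Iₙ₊₁) → R/J → 0. Counting lengths (`len_koszul`) gives vₙ₊₂ = E
+ 2h(n+1) − h(n) − h(n+2), which is `v_add_two_eq`.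

For large n, rr(Iₙ) = Iₙ (`exists_rr_top_eq`) and J·Iₙ = Iₙ₊₁, so vₙ vanishes. Summing the second
difference twice from h(0) = 0 (`quadratic_of_second_difference`) shows that h, and with it λ(R/Iₙ),
is eventually quadratic with coefficients E, ∑ vₙ and ∑ (n−1)vₙ. Uniqueness of the coefficients then
identifies these with e₀, e₁, e₂. -/

namespace HilbertFiltration

open Filter IsLocalRing
open scoped Pointwise

/-! ### Regular sequences of length two and Koszul syzygies. -/

section Syzygies

variable {R : Type*} [CommRing R]

/-- If the ideal `(x, y)` contains a regular sequence `a, b`, then the only syzygies of `x, y` are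
the Koszul ones. -/
theorem exists_koszul_of_syzygy {x y a b p q : R} (ha : a ∈ Ideal.span {x, y})
    (hb : b ∈ Ideal.span {x, y}) (hra : ∀ z, a * z = 0 → z = 0)
    (hrb : ∀ z, a ∣ b * z → a ∣ z) (h : p * x + q * y = 0) :
    ∃ c, p = c * y ∧ q = -(c * x) := by
  obtain ⟨s, t, rfl⟩ := Ideal.mem_span_pair.1 ha
  obtain ⟨u, w, rfl⟩ := Ideal.mem_span_pair.1 hb
  -- Modulo the syzygy, b(tp − sq) = a(wp − uq). Hence tp − sq = ac, and cancelling a in a(p − cy) =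
  -- 0 and a(q + cx) = 0 finishes.
  obtain ⟨c, hc⟩ := hrb (t * p - s * q) ⟨w * p - u * q, by
    linear_combination (u * t - w * s) * h⟩
  refine ⟨c, sub_eq_zero.1 (hra _ ?_), sub_eq_zero.1 (hra _ ?_)⟩
  · linear_combination s * h + y * hc
  · linear_combination t * h - x * hc

/-- Factors of `a` are cancelled one at a time. Together with the next two lemmas, this keeps a pair
regular when both entries are replaced by powers. -/
theorem dvd_of_pow_dvd_mul {a b : R} (hra : ∀ z, a * z = 0 → z = 0)
    (hrb : ∀ z, a ∣ b * z → a ∣ z) (n : ℕ) (z : R) (h : a ^ n ∣ b * z) : a ^ n ∣ z := by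
  induction n generalizing z with
  | zero => simp
  | succ n ih =>
    obtain ⟨w, hw⟩ := h
    obtain ⟨z, rfl⟩ := hrb z ⟨a ^ n * w, by rw [hw, pow_succ']; ring⟩
    have : b * z = a ^ n * w := sub_eq_zero.1 (hra _ (by linear_combination hw))
    rw [pow_succ']
    exact mul_dvd_mul_left a (ih z ⟨w, this⟩)

theorem dvd_of_dvd_pow_mul {a b : R} (hrb : ∀ z, a ∣ b * z → a ∣ z) (n : ℕ) (z : R)
    (h : a ∣ b ^ n * z) : a ∣ z := by
  induction n with
  | zero => simpa using h
  | succ n ih => exact ih (hrb _ (by rwa [← mul_assoc, ← pow_succ']))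

theorem eq_zero_of_pow_mul_eq_zero {a : R} (hra : ∀ z, a * z = 0 → z = 0) (n : ℕ) (z : R)
    (h : a ^ n * z = 0) : z = 0 := by
  induction n with
  | zero => simpa using h
  | succ n ih => exact ih (hra _ (by rwa [← mul_assoc, ← pow_succ']))

/-- In a local ring of depth at least two, every ideal containing a power of the maximal ideal
contains a regular sequence of length two. -/
theorem exists_regular_pair_mem [IsLocalRing R] (hdepth : 2 ≤ depth R) {J : Ideal R} {n : ℕ}
    (hJ : maximalIdeal R ^ n ≤ J) :
    ∃ a ∈ J, ∃ b ∈ J, (∀ z, a * z = 0 → z = 0) ∧ ∀ z, a ∣ b * z → a ∣ z := by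
  have h1 : (1 : ℕ∞) < depth R := lt_of_lt_of_le (by norm_num) hdepth
  rw [depth] at h1
  simp only [lt_iSup_iff] at h1
  obtain ⟨rs, ⟨hreg, hmem⟩, hlen⟩ := h1
  match rs, hreg, hmem, hlen with
  | [], _, _, hlen => simp at hlen
  | [_], _, _, hlen => simp at hlen
  | a :: b :: t, hreg, hmem, _ =>
    have hw := hreg.toIsWeaklyRegular
    rw [RingTheory.Sequence.isWeaklyRegular_cons_iff,
      RingTheory.Sequence.isWeaklyRegular_cons_iff] at hw
    obtain ⟨ha, hb, -⟩ := hw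
    have hra : ∀ z, a * z = 0 → z = 0 := fun z hz => ha (by simpa using hz)
    have hrb : ∀ z, a ∣ b * z → a ∣ z := by
      have key : ∀ z : R, z ∈ a • (⊤ : Submodule R R) ↔ a ∣ z := fun z => by
        simp [Submodule.mem_smul_pointwise_iff_exists, dvd_def, eq_comm]
      intro z hz
      rw [← key] at hz ⊢
      rw [← Submodule.Quotient.mk_eq_zero]
      refine hb ?_
      change b • Submodule.Quotient.mk z = b • (0 : R ⧸ a • (⊤ : Submodule R R))
      rw [smul_zero, ← Submodule.Quotient.mk_smul, Submodule.Quotient.mk_eq_zero]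
      exact hz
    refine ⟨a ^ n, hJ (Ideal.pow_mem_pow (hmem a (by simp)) n), b ^ n,
      hJ (Ideal.pow_mem_pow (hmem b (by simp)) n), eq_zero_of_pow_mul_eq_zero hra n, ?_⟩
    exact dvd_of_dvd_pow_mul (dvd_of_pow_dvd_mul hra hrb n) n

end Syzygies

/-! ### Finite length and the Koszul length count. -/

section Length

variable {R : Type*} [CommRing R]

/-- A nonzero quotient is a Noetherian local ring with nilpotent maximal ideal, hence Artinian. -/
theorem length_quotient_ne_top [IsLocalRing R] [IsNoetherianRing R] {I : Ideal R} {n : ℕ}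
    (hI : maximalIdeal R ^ n ≤ I) : Module.length R (R ⧸ I) ≠ ⊤ := by
  rcases subsingleton_or_nontrivial (R ⧸ I) with h | h
  · simp [Module.length_eq_zero]
  have : IsLocalRing (R ⧸ I) := .of_surjective' (Ideal.Quotient.mk I) Ideal.Quotient.mk_surjective
  have : IsArtinianRing (R ⧸ I) := by
    rw [isArtinianRing_iff_isNilpotent_maximalIdeal]
    refine ⟨n, ?_⟩
    have hm : maximalIdeal (R ⧸ I) = (maximalIdeal R).map (Ideal.Quotient.mk I) := by
      have h := IsLocalRing.map_maximalIdeal_of_surjective (Ideal.Quotient.mk I)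
        Ideal.Quotient.mk_surjective
      exact h.symm
    rw [hm, ← Ideal.map_pow, Ideal.zero_eq_bot, Ideal.map_eq_bot_iff_le_ker, Ideal.mk_ker]
    exact hI
  have : IsArtinian R (R ⧸ I) := isArtinian_of_surjective_algebraMap (S := R) (R := R ⧸ I) Ideal.Quotient.mk_surjective
  exact Module.length_ne_top

theorem len_quotient_eq_add {I K : Ideal R} (h : K ≤ I)
    (hK : Module.length R (R ⧸ K) ≠ ⊤) :
    len R (R ⧸ K) = len R (R ⧸ I) + len R (I ⧸ K.submoduleOf I) := by
  let f : (I ⧸ K.submoduleOf I) →ₗ[R] R ⧸ K :=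
    Submodule.mapQ (K.submoduleOf I) K I.subtype le_rfl
  let g : (R ⧸ K) →ₗ[R] R ⧸ I := Submodule.factor h
  have hf : Function.Injective f := by
    rw [← LinearMap.ker_eq_bot]
    exact (Submodule.ker_mapQ ..).trans (Submodule.mkQ_map_self _)
  have hg : Function.Surjective g := Submodule.factor_surjective h
  have hfg : Function.Exact f g := by
    rw [LinearMap.exact_iff]
    refine (Submodule.ker_mapQ ..).trans (Eq.trans ?_ (Submodule.range_mapQ ..).symm)
    rw [Submodule.comap_id, Submodule.range_subtype]
  have := Module.length_eq_add_of_exact f g hf hg hfg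
  rw [this] at hK
  rw [len, this, ENat.toNat_add (by aesop) (by aesop), Nat.cast_add, add_comm]
  rfl

/-- The length count of the Koszul complex of `x, y` with coefficients in `R / L`. -/
theorem len_koszul {x y : R} {L : Ideal R}
    (hsyz : ∀ p q, p * x + q * y = 0 → ∃ c, p = c * y ∧ q = -(c * x)) {K : Ideal R}
    (hK : ∀ z, z ∈ K ↔ z * x ∈ L ∧ z * y ∈ L)
    (hL : Module.length R (R ⧸ L) ≠ ⊤)
    (hJL : Module.length R (R ⧸ Ideal.span {x, y} * L) ≠ ⊤) :
    len R (R ⧸ K) + len R (R ⧸ Ideal.span {x, y} * L) =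
      2 * len R (R ⧸ L) + len R (R ⧸ Ideal.span {x, y}) := by
  set J := Ideal.span {x, y} with hJ
  have hx : x ∈ J := Ideal.subset_span (by simp)
  have hy : y ∈ J := Ideal.subset_span (by simp)
  -- The Koszul maps z ↦ (zy, −zx) and (p, q) ↦ xp + yq. The four-term exact sequence is split at
  -- the range of `g`, which is J/JL.
  let f : (R ⧸ K) →ₗ[R] (R ⧸ L) × (R ⧸ L) :=
    (K.mapQ L (LinearMap.mulRight R y) fun z hz => ((hK z).1 hz).2).prod
      (-(K.mapQ L (LinearMap.mulRight R x) fun z hz => ((hK z).1 hz).1))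
  let g : (R ⧸ L) × (R ⧸ L) →ₗ[R] R ⧸ J * L :=
    (L.mapQ (J * L) (LinearMap.mulLeft R x) fun z hz => Ideal.mul_mem_mul hx hz).coprod
      (L.mapQ (J * L) (LinearMap.mulLeft R y) fun z hz => Ideal.mul_mem_mul hy hz)
  have hf_mk (z : R) : f (Ideal.Quotient.mk K z) =
      (Ideal.Quotient.mk L (z * y), -Ideal.Quotient.mk L (z * x)) := rfl
  have hg_mk (p q : R) : g (Ideal.Quotient.mk L p, Ideal.Quotient.mk L q) =
      Ideal.Quotient.mk (J * L) (x * p + y * q) := rfl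
  have hf : Function.Injective f := by
    rw [injective_iff_map_eq_zero]
    intro z
    obtain ⟨z, rfl⟩ := Ideal.Quotient.mk_surjective z
    rw [hf_mk, Prod.mk_eq_zero, neg_eq_zero, Ideal.Quotient.eq_zero_iff_mem,
      Ideal.Quotient.eq_zero_iff_mem, Ideal.Quotient.eq_zero_iff_mem, hK]
    exact And.symm
  have hmem (z : R) : z ∈ J * L ↔ ∃ p ∈ L, ∃ q ∈ L, x * p + y * q = z := by
    rw [hJ, Ideal.span_insert, Ideal.sup_mul, Submodule.mem_sup]
    simp [Ideal.mem_span_singleton_mul]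
  have hfg : Function.Exact f g.rangeRestrict := by
    rintro ⟨p, q⟩
    obtain ⟨p, rfl⟩ := Ideal.Quotient.mk_surjective p
    obtain ⟨q, rfl⟩ := Ideal.Quotient.mk_surjective q
    rw [← Submodule.coe_eq_zero, LinearMap.codRestrict_apply, hg_mk,
      Ideal.Quotient.eq_zero_iff_mem, hmem]
    constructor
    · rintro ⟨p', hp', q', hq', h⟩
      -- Correcting (p, q) by a pair from L turns it into a genuine syzygy over R.
      obtain ⟨c, hc, hc'⟩ := hsyz (p - p') (q - q') (by linear_combination -h)
      refine ⟨Ideal.Quotient.mk K c, ?_⟩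
      rw [hf_mk, ← map_neg, Prod.mk.injEq, Ideal.Quotient.eq, Ideal.Quotient.eq, ← hc, ← hc']
      constructor
      · simpa using hp'
      · simpa using hq'
    · rintro ⟨c, hc⟩
      obtain ⟨c, rfl⟩ := Ideal.Quotient.mk_surjective c
      rw [hf_mk, ← map_neg, Prod.mk.injEq, Ideal.Quotient.eq, Ideal.Quotient.eq] at hc
      exact ⟨_, neg_mem hc.1, _, neg_mem hc.2, by ring⟩
  have h1 := Module.length_eq_add_of_exact f g.rangeRestrict hf g.surjective_rangeRestrict hfg
  let π : (R ⧸ J * L) →ₗ[R] R ⧸ J := Submodule.factor Ideal.mul_le_left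
  have hπ : Function.Exact (LinearMap.range g).subtype π := by
    intro z
    obtain ⟨z, rfl⟩ := Ideal.Quotient.mk_surjective z
    change Ideal.Quotient.mk J z = 0 ↔ _
    rw [Ideal.Quotient.eq_zero_iff_mem, Submodule.coe_subtype, Subtype.range_coe]
    constructor
    · intro hz
      obtain ⟨p, q, rfl⟩ := Ideal.mem_span_pair.1 hz
      exact ⟨(Ideal.Quotient.mk L p, Ideal.Quotient.mk L q), by rw [hg_mk]; congr 1; ring⟩
    · rintro ⟨⟨p, q⟩, h⟩
      obtain ⟨p, rfl⟩ := Ideal.Quotient.mk_surjective p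
      obtain ⟨q, rfl⟩ := Ideal.Quotient.mk_surjective q
      rw [hg_mk, Ideal.Quotient.eq] at h
      have h2 := J.sub_mem (J.add_mem (J.mul_mem_right p hx) (J.mul_mem_right q hy))
        (Ideal.mul_le_left h)
      simpa using h2
  have h2 := Module.length_eq_add_of_exact _ π (Submodule.subtype_injective _)
    (Submodule.factor_surjective Ideal.mul_le_left) hπ
  rw [Module.length_prod] at h1
  have hsum : Module.length R (R ⧸ L) + Module.length R (R ⧸ L) ≠ ⊤ := by simp [hL]
  rw [h1] at hsum
  have e1 := congrArg ENat.toNat h1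
  have e2 := congrArg ENat.toNat h2
  rw [h2] at hJL
  rw [Ne, ENat.add_eq_top, not_or] at hsum hJL
  rw [ENat.toNat_add hL hL, ENat.toNat_add hsum.1 hsum.2] at e1
  rw [ENat.toNat_add hJL.1 hJL.2] at e2
  unfold len
  omega

end Length

/-! ### The Ratliff–Rush filtration. -/

section RatliffRush

variable {R : Type*} [CommRing R]

theorem mem_rr_top_iff {F : ℕ → Ideal R} (hF : ∀ n m, F n * F m ≤ F (n + m)) {n : ℕ} {z : R} :
    z ∈ rr ⊤ F n ↔ ∃ k, ∀ a ∈ F 1 ^ k, z * a ∈ F (n + k) := by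
  rw [mem_rr_iff _ _ hF]
  simp only [Ideal.top_mul]
  refine ⟨fun ⟨k, _, h⟩ => ⟨k, h⟩, fun ⟨k, h⟩ => ⟨k + 1, by omega, fun a ha => ?_⟩⟩
  rw [pow_succ] at ha
  refine Submodule.mul_induction_on ha (fun b hb c hc => ?_) fun b c hb hc => ?_
  · rw [← mul_assoc, ← add_assoc]
    exact hF _ _ (Ideal.mul_mem_mul (h b hb) hc)
  · rw [mul_add]
    exact add_mem hb hc

theorem exists_forall_mul_mem_of_le {F : ℕ → Ideal R} (hF : ∀ n m, F n * F m ≤ F (n + m))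
    {n k l : ℕ} (hkl : k ≤ l) {z : R} (h : ∀ a ∈ F 1 ^ k, z * a ∈ F (n + k)) :
    ∀ a ∈ F 1 ^ l, z * a ∈ F (n + l) := by
  induction l, hkl using Nat.le_induction with
  | base => exact h
  | succ l _ ih =>
    intro a ha
    rw [pow_succ] at ha
    refine Submodule.mul_induction_on ha (fun b hb c hc => ?_) fun b c hb hc => ?_
    · rw [← mul_assoc, ← add_assoc]
      exact hF _ _ (Ideal.mul_mem_mul (ih b hb) hc)
    · rw [mul_add]
      exact add_mem hb hc

theorem le_rr_top {F : ℕ → Ideal R} (hF : ∀ n m, F n * F m ≤ F (n + m)) (n : ℕ) :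
    F n ≤ rr ⊤ F n := fun z hz =>
  (mem_rr_top_iff hF).2 ⟨1, fun a ha => hF _ _ (Ideal.mul_mem_mul hz (by simpa using ha))⟩

theorem mul_rr_top_le {F : ℕ → Ideal R} (hF : ∀ n m, F n * F m ≤ F (n + m)) (n : ℕ) :
    F 1 * rr ⊤ F n ≤ rr ⊤ F (n + 1) := by
  refine Ideal.mul_le.2 fun w hw z hz => ?_
  obtain ⟨k, hk⟩ := (mem_rr_top_iff hF).1 hz
  refine (mem_rr_top_iff hF).2 ⟨k, fun a ha => ?_⟩
  have := hF _ _ (Ideal.mul_mem_mul hw (hk a ha))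
  rwa [← mul_assoc, ← add_assoc, add_comm 1 n] at this

/-- The colon property of the Ratliff–Rush filtration with respect to a reduction. -/
theorem mem_rr_top_iff_forall_mul_mem {F : ℕ → Ideal R} (hF : ∀ n m, F n * F m ≤ F (n + m))
    {J : Ideal R} (hJ : IsReduction J (F 1)) {n : ℕ} {z : R} {S : Set R} (hS : S.Finite)
    (hJS : J = Ideal.span S) :
    z ∈ rr ⊤ F n ↔ ∀ s ∈ S, z * s ∈ rr ⊤ F (n + 1) := by
  constructor
  · intro hz s hs
    rw [mul_comm]
    exact mul_rr_top_le hF n (Ideal.mul_mem_mul (hJ.1 (hJS ▸ Ideal.subset_span hs)) hz)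
  · intro h
    obtain ⟨r, hr⟩ := hJ.2
    choose! k hk using fun s hs => (mem_rr_top_iff hF).1 (h s hs)
    obtain ⟨M, hM⟩ := (hS.image k).bddAbove
    have hMr : ∀ s ∈ S, ∀ a ∈ F 1 ^ (M + r), z * s * a ∈ F (n + 1 + (M + r)) := fun s hs =>
      exists_forall_mul_mem_of_le hF ((hM ⟨s, hs, rfl⟩).trans (Nat.le_add_right _ _)) (hk s hs)
    refine (mem_rr_top_iff hF).2 ⟨M + r + 1, fun a ha => ?_⟩
    have e : F 1 ^ (M + r + 1) = Ideal.span S * F 1 ^ (M + r) := by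
      rw [← hJS, add_assoc, pow_add, ← hr, pow_add]
      ring
    rw [e] at ha
    refine Submodule.mul_induction_on ha (fun b hb c hc => ?_) fun b c hb hc => ?_
    · induction hb using Submodule.span_induction with
      | mem s hs =>
        have := hMr s hs c hc
        rwa [mul_assoc, add_assoc, add_comm 1] at this
      | zero => simp
      | add p q _ _ hp hq =>
        rw [add_mul, mul_add]
        exact add_mem hp hq
      | smul t p _ hp =>
        rw [smul_eq_mul, mul_assoc, mul_left_comm]
        exact Ideal.mul_mem_left _ _ hp
    · rw [mul_add]
      exact add_mem hb hc

/-- A good filtration, viewed as a filtration with respect to its first ideal. -/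
def toFiltration (F : ℕ → Ideal R) (hanti : Antitone F) (hF : ∀ n m, F n * F m ≤ F (n + m)) :
    (F 1).Filtration R where
  N := F
  mono i := hanti (Nat.le_succ i)
  smul_le i := by
    rw [smul_eq_mul, add_comm i 1]
    exact hF 1 i

/-- The subfiltration of elements of `F n` multiplying `F 1` into `F (n + 2)`. -/
def colonFiltration (F : ℕ → Ideal R) (hanti : Antitone F)
    (hF : ∀ n m, F n * F m ≤ F (n + m)) : (F 1).Filtration R where
  N n := F n ⊓ (F (n + 2)).colon (F 1 : Set R)
  mono i := inf_le_inf (hanti (Nat.le_succ i))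
    (Submodule.colon_mono (hanti (by omega)) le_rfl)
  smul_le i := by
    rw [smul_eq_mul]
    refine Ideal.mul_le.2 fun a ha z hz => ?_
    have h1 := Submodule.mem_colon.1 hz.2 a ha
    rw [smul_eq_mul, mul_comm] at h1
    refine ⟨hanti (by omega) h1, Submodule.mem_colon.2 fun b hb => ?_⟩
    exact hF (i + 2) 1 (Ideal.mul_mem_mul h1 hb)

/-- Multiplication by a reduction of `F 1` eventually shifts a good filtration. -/
theorem exists_reduction_mul_eq {F : ℕ → Ideal R}
    (hgood : ∃ p, ∀ n, p ≤ n → F 1 * F n = F (n + 1)) {J : Ideal R}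
    (hJ : IsReduction J (F 1)) : ∃ N, ∀ n, N ≤ n → J * F n = F (n + 1) := by
  obtain ⟨p, hp⟩ := hgood
  obtain ⟨r, hr⟩ := hJ.2
  have key (k : ℕ) : F (p + k) = F 1 ^ k * F p := by
    induction k with
    | zero => simp
    | succ k ih => rw [← add_assoc, ← hp _ (by omega), ih, pow_succ', mul_assoc]
  refine ⟨p + r, fun n hn => ?_⟩
  obtain ⟨k, rfl⟩ : ∃ k, n = p + (r + k) := ⟨n - p - r, by omega⟩
  rw [add_assoc p, key, key, ← mul_assoc, pow_add, ← mul_assoc, hr]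
  ring

variable [IsNoetherianRing R]

/-- For a regular element `a`, one has `(F (n + c) : a) ⊆ F 1 ^ n` for some `c` and all `n`. -/
theorem exists_colon_le_pow {F : ℕ → Ideal R} (hanti : Antitone F)
    (hF : ∀ n m, F n * F m ≤ F (n + m)) (hgood : ∃ p, ∀ n, p ≤ n → F 1 * F n = F (n + 1))
    {a : R} (hra : ∀ z, a * z = 0 → z = 0) :
    ∃ c, ∀ n z, a * z ∈ F (n + c) → z ∈ F 1 ^ n := by
  have hst : (toFiltration F hanti hF).Stable := hgood
  -- Artin–Rees: Iₙ₊c ∩ (a) = I₁ⁿ(I_c ∩ (a)) ⊆ I₁ⁿ·a, and a can be cancelled.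
  obtain ⟨c, hc⟩ :=
    (hst.inter_right (F' := Ideal.trivialFiltration (F 1) (Ideal.span {a}))).exists_pow_smul_eq
  refine ⟨c, fun n z hz => ?_⟩
  have h1 : a * z ∈ F 1 ^ n • (F c ⊓ Ideal.span {a}) := by
    have h2 : a * z ∈ F (c + n) ⊓ Ideal.span {a} :=
      ⟨by rwa [add_comm], Ideal.mul_mem_right _ _ (Ideal.mem_span_singleton_self a)⟩
    exact (hc n).le h2
  have h3 : a * z ∈ F 1 ^ n * Ideal.span {a} := Ideal.mul_mono_right inf_le_right h1
  rw [Ideal.mem_mul_span_singleton] at h3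
  obtain ⟨w, hw, h⟩ := h3
  have : z = w := sub_eq_zero.1 (hra _ (by linear_combination -h))
  exact this ▸ hw

/-- The colon filtration lies inside a stable filtration over a Noetherian ring, so it is stable.
Its later terms are therefore I₁ times the preceding ones, and these products lie two steps deeper
by definition. -/
theorem exists_forall_mem_of_mul_mem {F : ℕ → Ideal R} (hanti : Antitone F)
    (hF : ∀ n m, F n * F m ≤ F (n + m)) (hgood : ∃ p, ∀ n, p ≤ n → F 1 * F n = F (n + 1)) :
    ∃ n₀, ∀ n, n₀ ≤ n → ∀ z ∈ F n, (∀ b ∈ F 1, z * b ∈ F (n + 2)) → z ∈ F (n + 1) := by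
  have hst : (toFiltration F hanti hF).Stable := hgood
  obtain ⟨n₀, hn₀⟩ := hst.of_le (F' := colonFiltration F hanti hF) fun n => inf_le_left
  refine ⟨n₀ + 1, fun n hn z hz h => ?_⟩
  obtain ⟨n, rfl⟩ : ∃ k, n = k + 1 := ⟨n - 1, by omega⟩
  have h1 : z ∈ (colonFiltration F hanti hF).N (n + 1) := ⟨hz, Submodule.mem_colon.2 h⟩
  rw [← hn₀ n (by omega)] at h1
  refine Submodule.smul_induction_on h1 (fun b hb w hw => ?_) fun u w hu hw => add_mem hu hw
  have h2 := Submodule.mem_colon.1 hw.2 b hb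
  rwa [smul_eq_mul, mul_comm] at h2

/-- The regular element `a` first places z in a fixed `F n₀`, at the cost of a bounded shift; the
previous lemma then lifts z one step at a time up to `F n`. -/
theorem exists_colon_le {F : ℕ → Ideal R} (hanti : Antitone F)
    (hF : ∀ n m, F n * F m ≤ F (n + m)) (hgood : ∃ p, ∀ n, p ≤ n → F 1 * F n = F (n + 1))
    (hpow : ∀ n, F 1 ^ n ≤ F n) {a : R} (ha : a ∈ F 1) (hra : ∀ z, a * z = 0 → z = 0) :
    ∃ N, ∀ n, N ≤ n → ∀ z, (∀ b ∈ F 1, z * b ∈ F (n + 1)) → z ∈ F n := by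
  obtain ⟨c, hc⟩ := exists_colon_le_pow hanti hF hgood hra
  obtain ⟨n₀, hn₀⟩ := exists_forall_mem_of_mul_mem hanti hF hgood
  refine ⟨n₀ + c, fun n hn z hz => ?_⟩
  have h0 : z ∈ F n₀ := hpow _ (hc n₀ z (by
    rw [mul_comm]
    exact hanti (by omega) (hz a ha)))
  have key : ∀ m, n₀ ≤ m → m ≤ n → z ∈ F m := by
    intro m hm
    induction m, hm using Nat.le_induction with
    | base => exact fun _ => h0
    | succ m hm ih =>
      exact fun hmn => hn₀ m hm z (ih (by omega)) fun b hb => hanti (by omega) (hz b hb)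
  exact key n (by omega) le_rfl

/-- The Ratliff–Rush filtration eventually agrees with the original one. -/
theorem exists_rr_top_eq {F : ℕ → Ideal R} (hanti : Antitone F)
    (hF : ∀ n m, F n * F m ≤ F (n + m)) (hgood : ∃ p, ∀ n, p ≤ n → F 1 * F n = F (n + 1))
    (hpow : ∀ n, F 1 ^ n ≤ F n) {a : R} (ha : a ∈ F 1) (hra : ∀ z, a * z = 0 → z = 0) :
    ∃ N, ∀ n, N ≤ n → rr ⊤ F n = F n := by
  obtain ⟨N, hN⟩ := exists_colon_le hanti hF hgood hpow ha hra
  refine ⟨N, fun n hn => le_antisymm (fun z hz => ?_) (le_rr_top hF n)⟩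
  obtain ⟨k, hk⟩ := (mem_rr_top_iff hF).1 hz
  -- One factor of I₁ is peeled off I₁ᵏ at each stage.
  induction k with
  | zero => simpa using hk 1 (by simp)
  | succ k ih =>
    refine ih fun b hb => hN (n + k) (by omega) _ fun w hw => ?_
    rw [mul_assoc]
    exact hk _ (by rw [pow_succ]; exact Ideal.mul_mem_mul hb hw)

end RatliffRush

/-! ### Second differences and Hilbert coefficients. -/

section SecondDifferences

/-- Partial sums of a sequence that is a constant minus the second difference of `h`. -/
theorem sum_of_second_difference {E : ℤ} {h v : ℕ → ℤ} (h0 : h 0 = 0) (h1 : v 1 = E - h 1)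
    (hv : ∀ n, v (n + 2) = E + 2 * h (n + 1) - h n - h (n + 2)) (m : ℕ) :
    ∑ n ∈ Finset.Icc 1 (m + 1), v n = (m + 1) * E - h (m + 1) + h m ∧
    2 * ∑ n ∈ Finset.Icc 1 (m + 1), ((n : ℤ) - 1) * v n =
      E * ((m + 1) * m) - 2 * m * h (m + 1) + 2 * (m + 1) * h m := by
  induction m with
  | zero => simp [h0, h1]
  | succ m ih =>
    rw [Finset.sum_Icc_succ_top (Nat.le_add_left 1 (m + 1)),
      Finset.sum_Icc_succ_top (Nat.le_add_left 1 (m + 1)), mul_add 2 (∑ n ∈ _, _), ih.1, ih.2, hv]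
    push_cast
    constructor <;> ring

theorem two_mul_choose_two (n : ℕ) : 2 * (((n + 1).choose 2 : ℕ) : ℤ) = (n + 1) * n := by
  have h2 := Nat.choose_two_right (n + 1)
  have h3 : 2 * ((n + 1).choose 2) = (n + 1) * n := by
    rw [h2]
    simpa using Nat.mul_div_cancel' (Nat.even_mul_pred_self (n + 1)).two_dvd
  exact_mod_cast h3

/-- A sequence whose second difference is eventually constant is eventually quadratic. -/
theorem quadratic_of_second_difference {E : ℤ} {h v : ℕ → ℤ} (h0 : h 0 = 0) (h1 : v 1 = E - h 1)
    (hv : ∀ n, v (n + 2) = E + 2 * h (n + 1) - h n - h (n + 2)) {N : ℕ}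
    (hN : ∀ n, N ≤ n → v n = 0) (n : ℕ) (hn : N ≤ n) :
    h n = E * ((n + 1).choose 2 : ℕ) - (∑ i ∈ Finset.Icc 1 N, v i) * n +
      ∑ i ∈ Finset.Icc 1 N, ((i : ℤ) - 1) * v i := by
  have hsub : Finset.Icc 1 N ⊆ Finset.Icc 1 (n + 1) := Finset.Icc_subset_Icc_right (by omega)
  have key : ∀ i ∈ Finset.Icc 1 (n + 1), i ∉ Finset.Icc 1 N → v i = 0 := fun i hi hi' =>
    hN i (by simp only [Finset.mem_Icc] at hi hi'; omega)
  rw [Finset.sum_subset hsub key,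
    Finset.sum_subset hsub fun i hi hi' => by rw [key i hi hi', mul_zero]]
  obtain ⟨e1, e2⟩ := sum_of_second_difference h0 h1 hv n
  have := two_mul_choose_two n
  refine mul_left_cancel₀ (two_ne_zero (α := ℤ)) ?_
  linear_combination -E * this + 2 * n * e1 - e2

theorem isHilbertCoeffs_two_iff {R : Type*} [CommRing R] {F : ℕ → Ideal R}
    {e : Fin (2 + 1) → ℤ} :
    IsHilbertCoeffs 2 F e ↔ ∀ᶠ n : ℕ in atTop, Module.length R (R ⧸ F n) ≠ ⊤ ∧
      len R (R ⧸ F n) = e 0 * ((n + 1).choose 2 : ℕ) - e 1 * n + e 2 := by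
  refine eventually_congr (Eventually.of_forall fun n => and_congr_right fun _ => ?_)
  rw [Fin.sum_univ_three]
  simp [sub_eq_add_neg]

theorem IsHilbertCoeffs.unique {R : Type*} [CommRing R] {F : ℕ → Ideal R}
    {e e' : Fin (2 + 1) → ℤ} (he : IsHilbertCoeffs 2 F e) (he' : IsHilbertCoeffs 2 F e') :
    e = e' := by
  rw [isHilbertCoeffs_two_iff] at he he'
  obtain ⟨N, hN⟩ := eventually_atTop.1 (he.and he')
  have key (k : ℕ) (hk : N ≤ k) := (hN k hk).1.2.symm.trans (hN k hk).2.2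
  have k0 := key N le_rfl
  have k1 := key (N + 1) (by omega)
  have k2 := key (N + 2) (by omega)
  have c0 := two_mul_choose_two N
  have c1 := two_mul_choose_two (N + 1)
  have c2 := two_mul_choose_two (N + 2)
  push_cast at k0 k1 k2 c0 c1 c2
  -- The second difference of the quadratic is its leading coefficient e₀.
  have d0 : e 0 = e' 0 := by
    refine mul_left_cancel₀ (two_ne_zero (α := ℤ)) ?_
    linear_combination 2 * k0 - 4 * k1 + 2 * k2 - (e 0 - e' 0) * (c0 - 2 * c1 + c2)
  rw [d0] at k0 k1
  have d1 : e 1 = e' 1 := by linear_combination k0 - k1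
  rw [d1] at k0
  have d2 : e 2 = e' 2 := by linear_combination k0
  ext i
  fin_cases i
  exacts [d0, d1, d2]

end SecondDifferences

/-! ### Assembling the second difference formula and the coefficients. -/

section Main

variable {R : Type*} [CommRing R]

theorem IsHilbertFiltration.pow_le [IsLocalRing R] {F : ℕ → Ideal R}
    (hF : IsHilbertFiltration F) (n : ℕ) : F 1 ^ n ≤ F n := by
  induction n with
  | zero => simp [hF.zero_eq_top]
  | succ n ih =>
    rw [pow_succ]
    exact (Ideal.mul_mono_left ih).trans (hF.mul_le n 1)

theorem IsHilbertFiltration.exists_maximalIdeal_pow_le [IsLocalRing R] [IsNoetherianRing R]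
    {F : ℕ → Ideal R} (hF : IsHilbertFiltration F) : ∃ N, ∀ n, maximalIdeal R ^ (N * n) ≤ F n := by
  obtain ⟨N, hN⟩ := (F 1).exists_radical_pow_le_of_fg (IsNoetherian.noetherian _)
  rw [hF.radical_eq] at hN
  refine ⟨N, fun n => ?_⟩
  rw [pow_mul]
  exact (Ideal.pow_right_mono hN n).trans (hF.pow_le n)

theorem IsReduction.exists_maximalIdeal_pow_le [IsLocalRing R] {J I : Ideal R}
    (hJ : IsReduction J I) {N : ℕ} (hI : maximalIdeal R ^ N ≤ I) :
    ∃ M, maximalIdeal R ^ M ≤ J := by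
  obtain ⟨r, hr⟩ := hJ.2
  refine ⟨N * (r + 1), ?_⟩
  rw [pow_mul]
  exact (Ideal.pow_right_mono hI _).trans (hr ▸ Ideal.mul_le_left)

/-- The second difference formula for the lengths `λ(R / rr(Iₙ))`. -/
theorem v_add_two_eq [IsLocalRing R] [IsNoetherianRing R] {F : ℕ → Ideal R}
    (hF : IsHilbertFiltration F) {x y : R} (hJ : IsReduction (Ideal.span {x, y}) (F 1))
    (hsyz : ∀ p q, p * x + q * y = 0 → ∃ c, p = c * y ∧ q = -(c * x)) (n : ℕ) :
    v ⊤ (Ideal.span {x, y}) F (n + 2) = len R (R ⧸ Ideal.span {x, y}) +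
      2 * len R (R ⧸ rr ⊤ F (n + 1)) - len R (R ⧸ rr ⊤ F n) - len R (R ⧸ rr ⊤ F (n + 2)) := by
  obtain ⟨N, hN⟩ := hF.exists_maximalIdeal_pow_le
  obtain ⟨M, hM⟩ := hJ.exists_maximalIdeal_pow_le (hN 1)
  have hrr : maximalIdeal R ^ (N * (n + 1)) ≤ rr ⊤ F (n + 1) :=
    (hN (n + 1)).trans (le_rr_top hF.mul_le _)
  have hJrr : maximalIdeal R ^ (M + N * (n + 1)) ≤ Ideal.span {x, y} * rr ⊤ F (n + 1) := by
    rw [pow_add]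
    exact Ideal.mul_mono hM hrr
  have hle : Ideal.span {x, y} * rr ⊤ F (n + 1) ≤ rr ⊤ F (n + 2) :=
    (Ideal.mul_mono_left hJ.1).trans (mul_rr_top_le hF.mul_le (n + 1))
  have hK (z : R) : z ∈ rr ⊤ F n ↔ z * x ∈ rr ⊤ F (n + 1) ∧ z * y ∈ rr ⊤ F (n + 1) := by
    rw [mem_rr_top_iff_forall_mul_mem hF.mul_le hJ (Set.toFinite {x, y}) rfl]
    simp
  have e1 := len_koszul hsyz hK (length_quotient_ne_top hrr) (length_quotient_ne_top hJrr)
  have e2 := len_quotient_eq_add hle (length_quotient_ne_top hJrr)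
  rw [v]
  linear_combination e1 - e2

/-- The sequence `vₙ` eventually vanishes. -/
theorem exists_v_eq_zero [IsNoetherianRing R] [IsLocalRing R] {F : ℕ → Ideal R}
    (hF : IsHilbertFiltration F) {J : Ideal R} (hJ : IsReduction J (F 1)) {N : ℕ}
    (hN : ∀ n, N ≤ n → rr ⊤ F n = F n) : ∃ M, ∀ n, M ≤ n → v ⊤ J F n = 0 := by
  obtain ⟨M, hM⟩ := exists_reduction_mul_eq hF.good hJ
  refine ⟨max M N + 2, fun n hn => ?_⟩
  obtain ⟨n, rfl⟩ : ∃ k, n = k + 2 := ⟨n - 2, by omega⟩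
  rw [v, hN (n + 1) (by omega), hN (n + 2) (by omega), hM (n + 1) (by omega), len,
    Module.length_eq_zero_iff.2]
  · rfl
  · rw [Submodule.Quotient.subsingleton_iff]
    exact Submodule.submoduleOf_self _

theorem finsum_one_le_eq_sum_Icc {f : ℕ → ℤ} {N : ℕ} (hN : ∀ n, N ≤ n → f n = 0) :
    ∑ᶠ (n : ℕ) (_ : 1 ≤ n), f n = ∑ n ∈ Finset.Icc 1 N, f n := by
  refine finsum_mem_eq_sum_of_inter_support_eq f (s := {n | 1 ≤ n}) (Set.ext fun n => ?_)
  simp only [Set.mem_inter_iff, Set.mem_ofPred_eq, Function.mem_support, Finset.coe_Icc,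
    Set.mem_Icc, and_congr_left_iff]
  exact fun hn => ⟨fun h => ⟨h, by_contra fun h' => hn (hN n (by omega))⟩, And.left⟩

end Main
end HilbertFiltration

open HilbertFiltration in
theorem mainTheorem12 {R : Type*} [CommRing R] [IsLocalRing R]
    (hCM : HilbertFiltration.IsCohenMacaulayLocal R) (hdim : ringKrullDim R = 2)
    (F : ℕ → Ideal R) (hF : HilbertFiltration.IsHilbertFiltration F)
    (x y : R) (hJ : HilbertFiltration.IsMinimalReduction (Ideal.span {x, y}) (F 1)) :
    (∃! e : Fin (2 + 1) → ℤ, HilbertFiltration.IsHilbertCoeffs 2 F e) ∧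
    {n : ℕ | HilbertFiltration.v ⊤ (Ideal.span {x, y}) F n ≠ 0}.Finite ∧
    HilbertFiltration.hilbertCoeff 2 F 1 =
      ∑ᶠ (n : ℕ) (_ : 1 ≤ n), HilbertFiltration.v ⊤ (Ideal.span {x, y}) F n ∧
    HilbertFiltration.hilbertCoeff 2 F 2 =
      ∑ᶠ (n : ℕ) (_ : 1 ≤ n), ((n : ℤ) - 1) * HilbertFiltration.v ⊤ (Ideal.span {x, y}) F n := by
  have := hCM.noetherian
  have hred : IsReduction (Ideal.span {x, y}) (F 1) := hJ.prop
  have hdepth : 2 ≤ depth R := by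
    have h := hCM.depth_eq
    rw [hdim] at h
    exact (WithBot.coe_injective h).ge
  obtain ⟨N, hN⟩ := hF.exists_maximalIdeal_pow_le
  obtain ⟨M, hM⟩ := hred.exists_maximalIdeal_pow_le (hN 1)
  obtain ⟨a, ha, b, hb, hra, hrb⟩ := exists_regular_pair_mem hdepth hM
  obtain ⟨N', hN'⟩ := exists_rr_top_eq hF.antitone hF.mul_le hF.good hF.pow_le (hred.1 ha) hra
  obtain ⟨M', hM'⟩ := exists_v_eq_zero hF hred hN'
  set J := Ideal.span {x, y}
  set E := len R (R ⧸ J)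
  set h : ℕ → ℤ := fun n => len R (R ⧸ rr ⊤ F n)
  have h0 : h 0 = 0 := by
    have htop : rr ⊤ F 0 = ⊤ := top_le_iff.1 (hF.zero_eq_top ▸ le_rr_top hF.mul_le 0)
    change len R (R ⧸ rr ⊤ F 0) = 0
    rw [len, Module.length_eq_zero_iff.2 (Submodule.Quotient.subsingleton_iff.2 htop)]
    rfl
  have hv (n : ℕ) : v ⊤ J F (n + 2) = E + 2 * h (n + 1) - h n - h (n + 2) :=
    v_add_two_eq hF hred (fun p q => exists_koszul_of_syzygy ha hb hra hrb) n
  -- `v` at 1 is defined through e₀, which is not yet known to equal E. The sequence `w` uses E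
  -- there, which avoids circularity; `w = v` follows once e₀ = E.
  let w : ℕ → ℤ := fun n => if n = 1 then E - h 1 else v ⊤ J F n
  -- T ≥ 2 keeps the modified index 1 out of the vanishing range, and T ≥ N' makes h(n) = λ(R/Iₙ)
  -- there.
  set T := max (max M' N') 2
  have hw : ∀ n, T ≤ n → w n = 0 := fun n hn => by
    rw [← hM' n (by omega)]
    exact if_neg (by omega)
  have hquad := quadratic_of_second_difference (v := w) h0 (if_pos rfl)
    (fun n => (if_neg (by omega)).trans (hv n)) hw
  have hcoeffs : IsHilbertCoeffs 2 F ![E, ∑ i ∈ Finset.Icc 1 T, w i,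
      ∑ i ∈ Finset.Icc 1 T, ((i : ℤ) - 1) * w i] := by
    rw [isHilbertCoeffs_two_iff]
    filter_upwards [Filter.eventually_ge_atTop T] with n hn
    refine ⟨length_quotient_ne_top (hN n), ?_⟩
    rw [← hN' n (by omega)]
    exact hquad n hn
  have heq : hilbertCoeff 2 F = _ :=
    (Classical.epsilon_spec (p := IsHilbertCoeffs 2 F) ⟨_, hcoeffs⟩).unique hcoeffs
  have hvw : v ⊤ J F 1 = w 1 := by
    have hE : hilbertCoeff 2 F 0 = E := congrFun heq 0
    change hilbertCoeff 2 F 0 - h 1 + 2 * h 0 = if 1 = 1 then E - h 1 else v ⊤ J F 1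
    rw [hE, h0, if_pos rfl]
    ring
  have hvw' : v ⊤ J F = w := funext fun n => by
    by_cases hn : n = 1
    · rw [hn, hvw]
    · exact (if_neg hn).symm
  refine ⟨⟨_, hcoeffs, fun e he => he.unique hcoeffs⟩, ?_, ?_, ?_⟩
  · refine (Set.finite_lt_nat M').subset fun n hn => ?_
    by_contra h'
    exact hn (hM' n (not_lt.1 h'))
  · rw [hvw', finsum_one_le_eq_sum_Icc hw, heq]
    rfl
  · rw [hvw', finsum_one_le_eq_sum_Icc (f := fun n => ((n : ℤ) - 1) * w n)
      fun n hn => by rw [hw n hn, mul_zero], heq]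
    rfl
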